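/- Consider the following mean field model. Fix integers $M\ge 1$ (agents per cluster), $N\ge 0$ (chunks per block), $T\ge 0$ (slots per frame), a delivery ratio $\eta\in(0,1]$ and a survival probability $\delta\in(0,1)$. Deficits take values in the countable set $\mathbb K=\{k\eta-m : k,m\in\mathbb Z_{\ge 0},\ m\le\lfloor k\eta\rfloor\}$. Let $\zeta$ be a probability distribution on $\{0,\dots,T\}$ (chunks received from the base station in a frame), and let $\mathcal P$ be the set of probability measures on $\mathbb K$ with finite mean. Let the regeneration distribution $\Psi$ belong to $\mathcal P$. *Allocation.* The state of a cluster is $\theta=((d_i,e_i))_{i=1}^M$, with deficits $d_i\in\mathbb K$ and chunk numbers $e_i\in\{0,\dots,T\}$. If agent $j$ broadcasts $a_j$ chunks, then agent $i$ decodes the block, written $\chi_i=1$ (and $\chi_i=0$ otherwise), if and only if $e_i+\sum_{j\ne i}a_j\ge N$. Let $S=\{i: N-e_i\le T,\ e_i+\sum_{j\neq i}e_j\ge N\}$. Let $a^*$ be a min-deficit-first allocation rule, that is, a function that maps each state $\theta$ to an allocation produced by the following procedure, in which one chunk is broadcast per slot. If $S=\emptyset$, nobody transmits. Otherwise (1)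 the agents outside $S$ transmit all their chunks, as long as some of the $T$ slots are left; then, while a slot is left and some agent of $S$ has not yet decoded, (2) each agent $i\in S$ transmits up to $\min(e_i,(e_i+T-N)^+)$ of its chunks, and (3) after that the agents of $S$ transmit their remaining chunks, one agent after the other, in increasing order of their deficits. Ties between deficits, and the order of the transmissions in (1) and (2), are resolved in an arbitrary way. *Deficit dynamics.* All agents report their states truthfully. Given a deficit distribution $\rho\in\mathcal P$, the deficit of a typical agent is the following Markov chain on $\mathbb K$. In each frame the agent is given a uniformly random label $i\in\{1,\dots,M\}$ in its cluster; its chunk number $e_i$ has law $\zeta$ and the states of the $M-1$ other agents are i.i.d. with law $\rho\times\zeta$, all of these being independent. With probability $\delta$ its deficit $d$ becomes $(d+\eta-\chi_i)^+$, where $\chi_i$ is evaluated at the allocation $a^*(\theta)$, and with probability $1-\delta$ the agent regenerates and its new deficit is drawn from $\Psi$. Call $\rho\in\mathcal P$ (together with truthful reporting) a *mean field equilibrium* if $\rho$ is the stationary distribution of this chain. **Theorem.** The mean field equilibrium is unique: if $\rho_1$ and $\rho_2$ are mean field equilibria, then $\rho_1=\rho_2$. -/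

import Mathlib

open MeasureTheory ProbabilityTheory

namespace D2DStreaming

/-- The set `𝕂 = {kη - m : k, m ≥ 0, m ≤ ⌊kη⌋}` of possible deficit values. -/
def deficitSet (η : ℝ) : Set ℝ :=
  {x | ∃ k m : ℕ, (m : ℤ) ≤ ⌊(k : ℝ) * η⌋ ∧ x = k * η - m}

/-- The deficit values as a type. It is countable, and all its subsets are measurable. -/
abbrev Deficit (η : ℝ) : Type := ↥(deficitSet η)

instance instCountableDeficit (η : ℝ) : Countable (Deficit η) := by
  have h : deficitSet η ⊆ Set.range (fun p : ℕ × ℕ => (p.1 : ℝ) * η - p.2) := by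
    rintro x ⟨k, m, -, rfl⟩
    exact ⟨(k, m), rfl⟩
  exact ((Set.countable_range _).mono h).to_subtype

theorem zero_mem_deficitSet (η : ℝ) : (0 : ℝ) ∈ deficitSet η :=
  ⟨0, 0, by simp, by simp⟩

theorem update_mem_deficitSet {η x : ℝ} (hx : x ∈ deficitSet η) (c : ℕ) :
    max (x + η - c) 0 ∈ deficitSet η := by
  obtain ⟨k, m, -, rfl⟩ := hx
  rcases le_total ((k : ℝ) * η - m + η - c) 0 with h | h
  · rw [max_eq_right h]
    exact zero_mem_deficitSet η
  · rw [max_eq_left h]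
    refine ⟨k + 1, m + c, ?_, ?_⟩
    · rw [Int.le_floor]
      push_cast
      linarith
    · push_cast
      ring

section Allocation

variable {M : ℕ}

/-- Agent `i`, who holds `e i` chunks from the base station, decodes the block under the
allocation `a` (`a j` is the number of chunks broadcast by agent `j`): its own chunks and the
chunks broadcast by the others together are at least the `N` chunks of the block. -/
def Decodes (N : ℕ) (e a : Fin M → ℕ) (i : Fin M) : Prop :=
  N ≤ e i + ∑ j ∈ Finset.univ.erase i, a j

open Classical in
/-- The indicator `χ i` of the event that agent `i` decodes the block. -/
noncomputable def chi (N : ℕ) (e a : Fin M → ℕ) (i : Fin M) : ℕ :=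
  if Decodes N e a i then 1 else 0

/-- Membership of agent `i` in the set `S` of the agents that are able to decode the block:
`N - e i ≤ T` and `e i + ∑_{j ≠ i} e j ≥ N`. -/
def CanDecode (N T : ℕ) (e : Fin M → ℕ) (i : Fin M) : Prop :=
  N ≤ e i + T ∧ N ≤ e i + ∑ j ∈ Finset.univ.erase i, e j

/-- The number `(e i + T - N)⁺` of extra chunks of an agent, which is capped at the number `e i`
of chunks that it holds (the cap matters only if `N < T`). -/
def extraChunks (N T : ℕ) (e : Fin M → ℕ) (i : Fin M) : ℕ :=
  min (e i) (e i + T - N)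

/-- After the transmissions `x` there is still a free slot among the `T` slots of the frame. -/
def HasTime (T : ℕ) (x : Fin M → ℕ) : Prop := ∑ i, x i < T

/-- After the transmissions `x`, some agent of `S` has not yet decoded the block. -/
def HasNeed (N T : ℕ) (e x : Fin M → ℕ) : Prop :=
  ∃ i, CanDecode N T e i ∧ ¬ Decodes N e x i

/-- One slot of the min-deficit-first allocation rule. `x j` is the number of chunks that agent `j`
has broadcast so far; in the slot some agent `i` broadcasts one more of its own `e i` chunks.
`ord j` is the place of agent `j` in the order of transmission that is used in the third phase. -/
inductive Slot (N T : ℕ) (e : Fin M → ℕ) (ord : Equiv.Perm (Fin M)) :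
    (Fin M → ℕ) → (Fin M → ℕ) → Prop
  /-- Phase 1 (only if `S` is non-empty): the agents outside `S` transmit all their chunks, as long
  as there is time. -/
  | phase1 (x : Fin M → ℕ) (i : Fin M)
      (hS : ∃ j, CanDecode N T e j)
      (hi : ¬ CanDecode N T e i) (hx : x i < e i) (htime : HasTime T x) :
      Slot N T e ord x (Function.update x i (x i + 1))
  /-- Phase 2, after phase 1: if there is time and need, an agent of `S` transmits one of its extra
  chunks. -/
  | phase2 (x : Fin M → ℕ) (i : Fin M)
      (h1 : ∀ j, ¬ CanDecode N T e j → x j = e j)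
      (hi : CanDecode N T e i) (hx : x i < extraChunks N T e i)
      (htime : HasTime T x) (hneed : HasNeed N T e x) :
      Slot N T e ord x (Function.update x i (x i + 1))
  /-- Phase 3, after phases 1 and 2: if there is time and need, the first agent of `S`, in the
  order `ord`, that still has chunks transmits one of them. -/
  | phase3 (x : Fin M → ℕ) (i : Fin M)
      (h1 : ∀ j, ¬ CanDecode N T e j → x j = e j)
      (h2 : ∀ j, CanDecode N T e j → extraChunks N T e j ≤ x j)
      (hi : CanDecode N T e i) (hx : x i < e i)
      (hord : ∀ j, CanDecode N T e j → ord j < ord i → x j = e j)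
      (htime : HasTime T x) (hneed : HasNeed N T e x) :
      Slot N T e ord x (Function.update x i (x i + 1))

/-- `a` is an outcome of the min-deficit-first allocation rule for the chunk numbers `e` and the
deficits `d`: for an order of the agents by increasing deficit (ties are broken in some way), `a` is
reached from no transmissions by a sequence of slots, and no further slot is possible. -/
def IsMinDeficitFirst (N T : ℕ) (d : Fin M → ℝ) (e a : Fin M → ℕ) : Prop :=
  ∃ ord : Equiv.Perm (Fin M), (∀ i j, d i < d j → ord i < ord j) ∧
    Relation.ReflTransGen (Slot N T e ord) 0 a ∧ ∀ a', ¬ Slot N T e ord a a'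

end Allocation

/-- The states `θ = ((d 1, e 1), …, (d M, e M))` of the agents of a cluster: deficit and number
of chunks received from the base station. -/
abbrev ClusterState (M T : ℕ) (η : ℝ) : Type := Fin M → Deficit η × Fin (T + 1)

/-- The chunk numbers of a cluster state. -/
def chunks {M T : ℕ} {η : ℝ} (θ : ClusterState M T η) (i : Fin M) : ℕ := ((θ i).2 : ℕ)

/-- The deficits of a cluster state. -/
def deficits {M T : ℕ} {η : ℝ} (θ : ClusterState M T η) (i : Fin M) : ℝ := ((θ i).1 : ℝ)

/-- `alloc` is a (deterministic) min-deficit-first allocation rule. -/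
def IsMinDeficitFirstRule {M : ℕ} (N T : ℕ) (η : ℝ)
    (alloc : ClusterState M T η → Fin M → ℕ) : Prop :=
  ∀ θ, IsMinDeficitFirst N T (deficits θ) (chunks θ) (alloc θ)

/-- The deficit `(d i + η - χ i)⁺` of agent `i` after a frame in which the cluster has state `θ`,
all agents report their states truthfully, and agent `i` does not regenerate. -/
noncomputable def nextDeficit {M : ℕ} (N T : ℕ) (η : ℝ)
    (alloc : ClusterState M T η → Fin M → ℕ) (θ : ClusterState M T η) (i : Fin M) : Deficit η :=
  ⟨max (((θ i).1 : ℝ) + η - chi N (chunks θ) (alloc θ) i) 0,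
    update_mem_deficitSet (θ i).1.2 _⟩

/-- The law of the next deficit of agent `i` of a cluster, given no regeneration and its present
deficit `d`: the other agents have i.i.d. states with law `ρ × ζ`, the chunk number of agent `i`
has law `ζ` (the deficit that is drawn for agent `i` itself is replaced by `d`). -/
noncomputable def lawNoRegeneration {M : ℕ} (N T : ℕ) (η : ℝ)
    (alloc : ClusterState M T η → Fin M → ℕ) (ζ : Measure (Fin (T + 1)))
    (ρ : Measure (Deficit η)) (i : Fin M) (d : Deficit η) : Measure (Deficit η) :=
  (Measure.pi fun _ : Fin M => ρ.prod ζ).map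
    fun θ => nextDeficit N T η alloc (Function.update θ i (d, (θ i).2)) i

/-- The transition kernel of the deficit of a typical agent, when the deficits of the other agents
have law `ρ`. In every frame the agents are randomly permuted and then put into clusters, so that
the label `i` of the typical agent within its cluster is uniform; at the end of the frame the agent
regenerates with probability `1 - δ`, its new deficit then having law `Ψ`. -/
noncomputable def deficitKernel {M : ℕ} (N T : ℕ) (η δ : ℝ)
    (alloc : ClusterState M T η → Fin M → ℕ) (ζ : Measure (Fin (T + 1)))
    (Ψ ρ : Measure (Deficit η)) : Kernel (Deficit η) (Deficit η) :=
  Kernel.ofFunOfCountable fun d =>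
    ENNReal.ofReal δ • ((M : ENNReal)⁻¹ • ∑ i, lawNoRegeneration N T η alloc ζ ρ i d)
      + ENNReal.ofReal (1 - δ) • Ψ

/-- `ρ` belongs to `𝒫`: a probability measure on the deficit values with finite mean. -/
def IsFiniteMeanProb {η : ℝ} (ρ : Measure (Deficit η)) : Prop :=
  IsProbabilityMeasure ρ ∧ Integrable (fun d : Deficit η => (d : ℝ)) ρ

/-- `ρ`, along with truthful reporting, is a mean field equilibrium: it is the stationary
distribution of the deficit of a typical agent that faces the deficit distribution `ρ`. -/
def IsMFE {M : ℕ} (N T : ℕ) (η δ : ℝ)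
    (alloc : ClusterState M T η → Fin M → ℕ) (ζ : Measure (Fin (T + 1)))
    (Ψ ρ : Measure (Deficit η)) : Prop :=
  IsFiniteMeanProb ρ ∧ (deficitKernel N T η δ alloc ζ Ψ ρ).Invariant ρ

end D2DStreaming

/-!
Two equilibria are compared through the tails `s ↦ ρ (s, ∞)` of their deficit distributions.

The allocation rule serves the agents with the largest deficits. An agent that is able to decode
fails to do so exactly if it transmits in the third phase. After the first two phases all agents that
are able to decode have the same number `N - T` of chunks left (`sub_baseChunks`), so the number of agents that decode is determined by the chunk numbers alone
(`IsMinDeficitFirst.sum_chi_eq`), whatever the deficits and the order are. As the decoding agents are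
the last ones in the order, the number of those with a deficit above a level `s` depends only on the
chunk numbers and on the set of the agents above `s` (`IsMinDeficitFirst.sum_chi_upper`).

Hence the probability that a typical agent decodes and has a deficit above `s` is a function `H` of
`q = ρ (s, ∞)` that does not involve `ρ` in any other way (`servedAbove`, `integral_served`). A larger
marked set contains at least as many decoding agents, and each new agent adds at most one, so both
`H` and `q ↦ q - H q` are nondecreasing (`abs_servedAbove_add`).

Stationarity becomes, for `t ≥ 0` and with `q t = ρ (t, ∞)`,
`q t = δ (q (t - η) - H (q (t - η)) + H (q (t - η + 1))) + (1 - δ) Ψ (t, ∞)` (`IsMFE.tail_eq`).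
By the two monotonicity properties and the translation invariance of Lebesgue measure, the `L¹`
distance of the tails of two equilibria is at most `δ` times itself (`IsMFE.integral_abs_le`). It is
finite because the means are, so it vanishes, and right-continuity of the tails does the rest.
-/

namespace D2DStreaming

/-! ### Outcomes of the allocation rule -/

section Outcomes

variable {M N T : ℕ} {e x a : Fin M → ℕ} {ord : Equiv.Perm (Fin M)}

theorem decodes_iff_add_le {i : Fin M} : Decodes N e x i ↔ N + x i ≤ e i + ∑ j, x j := by
  have h := Finset.add_sum_erase Finset.univ x (Finset.mem_univ i)
  unfold Decodes
  omega

theorem sum_update_succ (x : Fin M → ℕ) (i : Fin M) :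
    ∑ j, Function.update x i (x i + 1) j = ∑ j, x j + 1 := by
  rw [Finset.sum_update_of_mem (Finset.mem_univ i), ← Finset.add_sum_erase _ x (Finset.mem_univ i),
    Finset.sdiff_singleton_eq_erase]
  ring

/-- The properties of the transmissions `x` that every slot of the allocation rule preserves. An
agent that can decode and has broadcast more than its extra chunks has done so in the third phase,
so that the first two phases are complete and all the agents before it in the order have
transmitted everything. -/
structure SlotInvariant (N T : ℕ) (e : Fin M → ℕ) (ord : Equiv.Perm (Fin M)) (x : Fin M → ℕ) :
    Prop where
  le : ∀ i, x i ≤ e i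
  sum_le : ∑ i, x i ≤ T
  outside : ∀ i, CanDecode N T e i → extraChunks N T e i < x i →
    ∀ j, ¬ CanDecode N T e j → x j = e j
  extra : ∀ i, CanDecode N T e i → extraChunks N T e i < x i →
    ∀ j, CanDecode N T e j → extraChunks N T e j ≤ x j
  before : ∀ i, CanDecode N T e i → extraChunks N T e i < x i →
    ∀ j, CanDecode N T e j → ord j < ord i → x j = e j

theorem SlotInvariant.zero : SlotInvariant N T e ord 0 where
  le := by simp
  sum_le := by simp
  outside := by simp
  extra := by simp
  before := by simp

theorem SlotInvariant.slot {x' : Fin M → ℕ} (h : SlotInvariant N T e ord x)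
    (hs : Slot N T e ord x x') : SlotInvariant N T e ord x' := by
  have key : ∀ i, x i < e i → HasTime T x →
      (∀ j, Function.update x i (x i + 1) j ≤ e j) ∧
        ∑ j, Function.update x i (x i + 1) j ≤ T := by
    intro i hx ht
    refine ⟨fun j => ?_, ?_⟩
    · rcases eq_or_ne j i with rfl | hj
      · simpa using hx
      · simpa [hj] using h.le j
    · rw [sum_update_succ]
      exact ht
  cases hs with
  | phase1 i hS hi hx htime =>
    -- No agent is in the third phase, as `i` still has chunks.
    have hno : ∀ k, CanDecode N T e k →
        ¬ extraChunks N T e k < Function.update x i (x i + 1) k := by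
      intro k hk hlt
      have hki : k ≠ i := by rintro rfl; exact hi hk
      rw [Function.update_of_ne hki] at hlt
      have := h.outside k hk hlt i hi
      omega
    exact ⟨(key i hx htime).1, (key i hx htime).2, fun k hk hlt => absurd hlt (hno k hk),
      fun k hk hlt => absurd hlt (hno k hk), fun k hk hlt => absurd hlt (hno k hk)⟩
  | phase2 i h1 hi hx htime hneed =>
    -- No agent is in the third phase, as `i` still has extra chunks.
    have hno : ∀ k, CanDecode N T e k →
        ¬ extraChunks N T e k < Function.update x i (x i + 1) k := by
      intro k hk hlt
      rcases eq_or_ne k i with rfl | hki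
      · rw [Function.update_self] at hlt
        omega
      · rw [Function.update_of_ne hki] at hlt
        have := h.extra k hk hlt i hi
        omega
    have hx' : x i < e i := hx.trans_le (min_le_left _ _)
    exact ⟨(key i hx' htime).1, (key i hx' htime).2, fun k hk hlt => absurd hlt (hno k hk),
      fun k hk hlt => absurd hlt (hno k hk), fun k hk hlt => absurd hlt (hno k hk)⟩
  | phase3 i h1 h2 hi hx hord htime hneed =>
    refine ⟨(key i hx htime).1, (key i hx htime).2, fun k hk hlt j hj => ?_,
      fun k hk hlt j hj => ?_, fun k hk hlt j hj hjk => ?_⟩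
    · have hji : j ≠ i := by rintro rfl; exact hj hi
      rw [Function.update_of_ne hji]
      exact h1 j hj
    · refine (h2 j hj).trans ?_
      rcases eq_or_ne j i with rfl | hji
      · simp
      · simp [hji]
    · rcases eq_or_ne k i with rfl | hki
      · have hjk' : j ≠ k := by rintro rfl; exact lt_irrefl _ hjk
        rw [Function.update_of_ne hjk']
        exact hord j hj hjk
      · rw [Function.update_of_ne hki] at hlt
        have hfull := h.before k hk hlt j hj hjk
        have hji : j ≠ i := by rintro rfl; omega
        rwa [Function.update_of_ne hji]

theorem SlotInvariant.of_reachable (h : Relation.ReflTransGen (Slot N T e ord) 0 a) :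
    SlotInvariant N T e ord a := by
  induction h with
  | refl => exact .zero
  | tail _ hs ih => exact ih.slot hs

theorem SlotInvariant.canDecode_of_decodes (h : SlotInvariant N T e ord x) {i : Fin M}
    (hi : Decodes N e x i) : CanDecode N T e i := by
  refine ⟨?_, hi.trans (Nat.add_le_add_left (Finset.sum_le_sum fun j _ => h.le j) _)⟩
  have := decodes_iff_add_le.1 hi
  have := h.sum_le
  omega

/-- If the rule stops while some agent that can decode has not done so, then all slots are used:
otherwise all chunks would have been transmitted, and this agent would decode. -/
theorem sum_eq_of_terminal (h : SlotInvariant N T e ord a) (hterm : ∀ a', ¬ Slot N T e ord a a')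
    (hneed : HasNeed N T e a) : ∑ i, a i = T := by
  by_contra hne
  have htime : HasTime T a := lt_of_le_of_ne h.sum_le hne
  have h1 : ∀ j, ¬ CanDecode N T e j → a j = e j := fun j hj =>
    (h.le j).antisymm <| not_lt.1 fun hlt =>
      hterm _ (.phase1 a j (hneed.imp fun _ hi => hi.1) hj hlt htime)
  have h2 : ∀ j, CanDecode N T e j → extraChunks N T e j ≤ a j := fun j hj =>
    not_lt.1 fun hlt => hterm _ (.phase2 a j h1 hj hlt htime hneed)
  have h3 : ∀ j, CanDecode N T e j → a j = e j := by
    classical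
    by_contra! hex
    obtain ⟨j, hj, hja⟩ := hex
    -- The first agent, in the order of transmission, that still has chunks.
    obtain ⟨i, hi, hmin⟩ := Finset.exists_min_image
      (Finset.univ.filter fun i => CanDecode N T e i ∧ a i ≠ e i) ord ⟨j, by simp [hj, hja]⟩
    simp only [Finset.mem_filter, Finset.mem_univ, true_and] at hi hmin
    refine hterm _ (.phase3 a i h1 h2 hi.1 (lt_of_le_of_ne (h.le i) hi.2) (fun k hk hlt => ?_)
      htime hneed)
    by_contra hka
    exact absurd hlt (not_lt.2 (hmin k ⟨hk, hka⟩))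
  obtain ⟨i, hi, hni⟩ := hneed
  have hae : a = e := funext fun j => by
    by_cases hj : CanDecode N T e j
    exacts [h3 j hj, h1 j hj]
  subst hae
  exact hni hi.2

open Classical in
/-- The number of chunks that an agent has broadcast after the first two phases, if time and need
last that long. -/
noncomputable def baseChunks (N T : ℕ) (e : Fin M → ℕ) (i : Fin M) : ℕ :=
  if CanDecode N T e i then extraChunks N T e i else e i

/-- The outcomes in which some agent that can decode does not do so: all slots are used, the first
two phases are complete, and the agents that do not decode are those that transmit in the third
phase. -/
structure IsSaturated (N T : ℕ) (e : Fin M → ℕ) (ord : Equiv.Perm (Fin M)) (a : Fin M → ℕ) :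
    Prop where
  le : ∀ i, a i ≤ e i
  sum_eq : ∑ i, a i = T
  lt : T < N
  exists_base_lt : ∃ i, baseChunks N T e i < a i
  base_le : ∀ i, baseChunks N T e i ≤ a i
  decodes_iff : ∀ i, CanDecode N T e i → (Decodes N e a i ↔ a i ≤ baseChunks N T e i)
  canDecode : ∀ i, baseChunks N T e i < a i → CanDecode N T e i
  before : ∀ i, baseChunks N T e i < a i →
    ∀ j, CanDecode N T e j → ord j < ord i → a j = e j

theorem IsSaturated.of_hasNeed (h : SlotInvariant N T e ord a)
    (hterm : ∀ a', ¬ Slot N T e ord a a') (hneed : HasNeed N T e a) :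
    IsSaturated N T e ord a := by
  have hsum := sum_eq_of_terminal h hterm hneed
  have hdec : ∀ i, CanDecode N T e i → (Decodes N e a i ↔ a i ≤ extraChunks N T e i) := by
    intro i hi
    have h1 := hi.1
    have h2 := h.le i
    rw [decodes_iff_add_le, hsum, extraChunks, le_min_iff]
    omega
  obtain ⟨i, hi, hni⟩ := hneed
  rw [hdec i hi, not_le] at hni
  have hb : ∀ j, CanDecode N T e j → baseChunks N T e j = extraChunks N T e j :=
    fun j hj => if_pos hj
  have hb' : ∀ j, ¬ CanDecode N T e j → baseChunks N T e j = e j := fun j hj => if_neg hj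
  have hcan : ∀ j, baseChunks N T e j < a j → CanDecode N T e j := by
    intro j hj
    by_contra hcon
    rw [hb' j hcon] at hj
    exact absurd (h.le j) (not_le.2 hj)
  refine ⟨h.le, hsum, ?_, ⟨i, by rwa [hb i hi]⟩, fun j => ?_, fun j hj => ?_, hcan, fun j hj => ?_⟩
  · have h1 := h.le i
    have h2 := hi.1
    unfold extraChunks at hni
    omega
  · by_cases hj : CanDecode N T e j
    · rw [hb j hj]
      exact h.extra i hi hni j hj
    · rw [hb' j hj, h.outside i hi hni j hj]
  · rw [hb j hj]
    exact hdec j hj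
  · have hcj := hcan j hj
    rw [hb j hcj] at hj
    exact h.before j hcj hj

/-- What an agent that can decode has left after the first two phases. That it is the same for all
these agents is the reason why the number of agents that decode does not depend on the order. -/
theorem sub_baseChunks {i : Fin M} (hi : CanDecode N T e i) (hTN : T ≤ N) :
    e i = baseChunks N T e i + (N - T) := by
  have := hi.1
  rw [baseChunks, if_pos hi, extraChunks]
  omega

theorem IsSaturated.sum_base_add (h : IsSaturated N T e ord a) :
    ∑ i, baseChunks N T e i +
      ∑ i with baseChunks N T e i < a i, (a i - baseChunks N T e i) = T := by
  rw [Finset.sum_filter, ← Finset.sum_add_distrib]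
  refine (Finset.sum_congr rfl fun i _ => ?_).trans h.sum_eq
  have := h.base_le i
  split_ifs <;> omega

theorem IsSaturated.sum_base_lt (h : IsSaturated N T e ord a) :
    ∑ i, baseChunks N T e i < T := by
  obtain ⟨i, hi⟩ := h.exists_base_lt
  exact (Finset.sum_lt_sum (fun j _ => h.base_le j) ⟨i, Finset.mem_univ i, hi⟩).trans_eq h.sum_eq

/-- The transmitters of the third phase can broadcast all that is transmitted in this phase. -/
theorem IsSaturated.le_card_mul (h : IsSaturated N T e ord a) :
    T ≤ ∑ i, baseChunks N T e i +
      (Finset.univ.filter fun i => baseChunks N T e i < a i).card * (N - T) := by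
  refine h.sum_base_add.symm.le.trans (Nat.add_le_add_left ?_ _)
  rw [← smul_eq_mul]
  refine Finset.sum_le_card_nsmul _ _ _ fun i hi => ?_
  have hi' := (Finset.mem_filter.1 hi).2
  have := sub_baseChunks (h.canDecode i hi') h.lt.le
  have := h.le i
  omega

/-- The transmitters of the third phase, except for the last one, broadcast everything. -/
theorem IsSaturated.card_mul_lt (h : IsSaturated N T e ord a) :
    ∑ i, baseChunks N T e i +
      (Finset.univ.filter fun i => baseChunks N T e i < a i).card * (N - T) < T + (N - T) := by
  obtain ⟨i₀, hi₀⟩ := h.exists_base_lt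
  obtain ⟨m, hm, hmax⟩ := Finset.exists_max_image
    (Finset.univ.filter fun i => baseChunks N T e i < a i) ord ⟨i₀, by simpa using hi₀⟩
  have hsum := h.sum_base_add
  rw [← Finset.add_sum_erase _ _ hm] at hsum
  have hrest : ∑ i ∈ (Finset.univ.filter fun i => baseChunks N T e i < a i).erase m,
      (a i - baseChunks N T e i) =
        ((Finset.univ.filter fun i => baseChunks N T e i < a i).card - 1) * (N - T) := by
    rw [Finset.sum_congr rfl (g := fun _ => N - T), Finset.sum_const, smul_eq_mul,
      Finset.card_erase_of_mem hm]
    intro i hi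
    obtain ⟨him, hiP⟩ := Finset.mem_erase.1 hi
    have hcan := h.canDecode i (Finset.mem_filter.1 hiP).2
    have hlt : ord i < ord m :=
      lt_of_le_of_ne (hmax i hiP) fun heq => him (ord.injective heq)
    rw [h.before m (Finset.mem_filter.1 hm).2 i hcan hlt]
    have := sub_baseChunks hcan h.lt.le
    omega
  rw [hrest] at hsum
  have hpos : 0 < (Finset.univ.filter fun i => baseChunks N T e i < a i).card :=
    Finset.card_pos.2 ⟨m, hm⟩
  have hm' := (Finset.mem_filter.1 hm).2
  obtain ⟨k, hk⟩ : ∃ k, (Finset.univ.filter fun i => baseChunks N T e i < a i).card = k + 1 :=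
    ⟨_, (Nat.succ_pred_eq_of_pos hpos).symm⟩
  rw [hk] at hsum ⊢
  simp only [Nat.add_sub_cancel] at hsum
  rw [Nat.add_mul, one_mul]
  omega

theorem IsSaturated.card_le {ord' : Equiv.Perm (Fin M)} {a' : Fin M → ℕ}
    (h : IsSaturated N T e ord a) (h' : IsSaturated N T e ord' a') :
    (Finset.univ.filter fun i => baseChunks N T e i < a i).card ≤
      (Finset.univ.filter fun i => baseChunks N T e i < a' i).card := by
  have h1 := h.card_mul_lt
  have h2 := h'.le_card_mul
  rw [← Nat.lt_succ_iff]
  refine lt_of_mul_lt_mul_right (a := N - T) ?_ (Nat.zero_le _)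
  rw [Nat.succ_mul]
  omega

open Classical in
theorem IsSaturated.card_decodes_add (h : IsSaturated N T e ord a) :
    (Finset.univ.filter fun i => CanDecode N T e i ∧ Decodes N e a i).card +
      (Finset.univ.filter fun i => baseChunks N T e i < a i).card =
        (Finset.univ.filter fun i => CanDecode N T e i).card := by
  rw [← Finset.card_filter_add_card_filter_not (s := Finset.univ.filter fun i => CanDecode N T e i)
    (fun i => Decodes N e a i), Finset.filter_filter, Finset.filter_filter]
  congr 2
  ext i
  simp only [Finset.mem_filter, Finset.mem_univ, true_and]
  refine ⟨fun hi => ⟨h.canDecode i hi, ?_⟩, fun hi => ?_⟩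
  · rw [h.decodes_iff i (h.canDecode i hi)]
    omega
  · rw [h.decodes_iff i hi.1] at hi
    omega

/-- The outcomes for the same chunk numbers agree on whether all agents of `S` decode. -/
theorem IsSaturated.not_forall_decodes {ord' : Equiv.Perm (Fin M)} {a' : Fin M → ℕ}
    (h : IsSaturated N T e ord a) (h' : SlotInvariant N T e ord' a') :
    ¬ ∀ i, CanDecode N T e i → Decodes N e a' i := by
  intro hall
  obtain ⟨i, hi⟩ := h.exists_base_lt
  have hci := h.canDecode i hi
  have hlt := h.sum_base_lt
  -- An agent that decodes has at least as many unused extra chunks as there are free slots.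
  have hfree : ∀ j, CanDecode N T e j → a' j + (T - ∑ k, a' k) ≤ baseChunks N T e j := by
    intro j hj
    have h1 := decodes_iff_add_le.1 (hall j hj)
    have h2 := sub_baseChunks hj h.lt.le
    have h3 := h'.sum_le
    have h4 := h.lt
    omega
  have hle : ∀ j, a' j ≤ baseChunks N T e j := by
    intro j
    by_cases hj : CanDecode N T e j
    · exact (Nat.le_add_right _ _).trans (hfree j hj)
    · rw [baseChunks, if_neg hj]
      exact h'.le j
  have h1 := Finset.add_sum_erase Finset.univ a' (Finset.mem_univ i)
  have h2 := Finset.add_sum_erase Finset.univ (baseChunks N T e) (Finset.mem_univ i)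
  have h3 := Finset.sum_le_sum fun j (_ : j ∈ Finset.univ.erase i) => hle j
  have h4 := hfree i hci
  have h5 := h'.sum_le
  omega

theorem sum_chi_eq_card (A : Finset (Fin M)) (h : SlotInvariant N T e ord a) :
    open Classical in ∑ i ∈ A, chi N e a i =
      (A.filter fun i => CanDecode N T e i ∧ Decodes N e a i).card := by
  classical
  rw [Finset.card_filter]
  refine Finset.sum_congr rfl fun i _ => ?_
  unfold chi
  by_cases hi : Decodes N e a i
  · simp [hi, h.canDecode_of_decodes hi]
  · simp [hi]

/-- The number of agents that decode does not depend on the deficits, nor on the way in which the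
rule resolves what it leaves open. -/
theorem IsMinDeficitFirst.sum_chi_eq {d d' : Fin M → ℝ} {a' : Fin M → ℕ}
    (h : IsMinDeficitFirst N T d e a) (h' : IsMinDeficitFirst N T d' e a') :
    ∑ i, chi N e a i = ∑ i, chi N e a' i := by
  classical
  obtain ⟨ord, -, hreach, hterm⟩ := h
  obtain ⟨ord', -, hreach', hterm'⟩ := h'
  have hinv := SlotInvariant.of_reachable hreach
  have hinv' := SlotInvariant.of_reachable hreach'
  rw [sum_chi_eq_card _ hinv, sum_chi_eq_card _ hinv']
  by_cases hn : HasNeed N T e a <;> by_cases hn' : HasNeed N T e a'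
  · have hs := IsSaturated.of_hasNeed hinv hterm hn
    have hs' := IsSaturated.of_hasNeed hinv' hterm' hn'
    have h1 := hs.card_decodes_add
    have h2 := hs'.card_decodes_add
    have h3 := hs.card_le hs'
    have h4 := hs'.card_le hs
    omega
  · have hs := IsSaturated.of_hasNeed hinv hterm hn
    simp only [HasNeed, not_exists, not_and, not_not] at hn'
    exact absurd hn' (hs.not_forall_decodes hinv')
  · have hs' := IsSaturated.of_hasNeed hinv' hterm' hn'
    simp only [HasNeed, not_exists, not_and, not_not] at hn
    exact absurd hn (hs'.not_forall_decodes hinv)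
  · simp only [HasNeed, not_exists, not_and, not_not] at hn hn'
    congr 1
    ext i
    simp only [Finset.mem_filter, Finset.mem_univ, true_and]
    exact ⟨fun hi => ⟨hi.1, hn' i hi.1⟩, fun hi => ⟨hi.1, hn i hi.1⟩⟩

/-- Among the agents that can decode, those that do so are the last ones in the order. -/
theorem decodes_of_ord_lt (h : SlotInvariant N T e ord a) (hterm : ∀ a', ¬ Slot N T e ord a a')
    {i j : Fin M} (hi : CanDecode N T e i) (hj : CanDecode N T e j) (hdi : Decodes N e a i)
    (hij : ord i < ord j) : Decodes N e a j := by
  by_contra hdj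
  have hs := IsSaturated.of_hasNeed h hterm ⟨j, hj, hdj⟩
  rw [hs.decodes_iff j hj, not_le] at hdj
  rw [hs.decodes_iff i hi, hs.before j hdj i hi hij, sub_baseChunks hi hs.lt.le] at hdi
  have := hs.lt
  omega

/-- The number of decoding agents in a set `A` that consists of the agents with the largest
deficits: the agents of `S` with the largest deficits decode, and their total number is determined
by the chunk numbers. -/
theorem IsMinDeficitFirst.sum_chi_upper {d : Fin M → ℝ} (h : IsMinDeficitFirst N T d e a)
    (A : Finset (Fin M)) (hA : ∀ i ∉ A, ∀ j ∈ A, d i < d j) :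
    open Classical in ∑ i ∈ A, chi N e a i =
      min (A.filter fun i => CanDecode N T e i).card (∑ i, chi N e a i) := by
  classical
  obtain ⟨ord, hord, hreach, hterm⟩ := h
  have hinv := SlotInvariant.of_reachable hreach
  rw [sum_chi_eq_card _ hinv, sum_chi_eq_card _ hinv]
  by_cases hex : ∃ i ∉ A, CanDecode N T e i ∧ Decodes N e a i
  · obtain ⟨i, hiA, hci, hdi⟩ := hex
    have heq : (A.filter fun i => CanDecode N T e i ∧ Decodes N e a i) =
        A.filter fun i => CanDecode N T e i :=
      Finset.filter_congr fun j hj => ⟨fun hj' => hj'.1, fun hj' =>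
        ⟨hj', decodes_of_ord_lt hinv hterm hci hj' hdi (hord i j (hA i hiA j hj))⟩⟩
    rw [min_eq_left, heq]
    rw [← heq]
    exact Finset.card_le_card (Finset.filter_subset_filter _ (Finset.subset_univ A))
  · push Not at hex
    have heq : (A.filter fun i => CanDecode N T e i ∧ Decodes N e a i) =
        Finset.univ.filter fun i => CanDecode N T e i ∧ Decodes N e a i := by
      ext i
      simp only [Finset.mem_filter, Finset.mem_univ, true_and]
      refine ⟨fun hi => hi.2, fun hi => ⟨?_, hi⟩⟩
      by_contra hiA
      exact hex i hiA hi.1 hi.2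
    rw [heq, min_eq_right]
    rw [← heq]
    exact Finset.card_le_card (Finset.monotone_filter_right _ fun i _ hi => hi.1)

end Outcomes

/-! ### The mean number of decoding agents above a quantile -/

section Quantile

open Set

variable {M N T : ℕ} {η : ℝ}

open Classical in
/-- The number of decoding agents among the marked agents of a cluster, if these are the agents with
the largest deficits. An agent is described by its mark and its chunk number; the total number of
decoding agents is computed with all deficits equal to `0`, as it does not depend on them. -/
noncomputable def markedServed (N : ℕ) (alloc : ClusterState M T η → Fin M → ℕ)
    (w : Fin M → Bool × Fin (T + 1)) : ℕ :=
  min (Finset.univ.filter fun i => (w i).1 = true ∧ CanDecode N T (fun j => ((w j).2 : ℕ)) i).card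
    (∑ i, chi N (fun j => ((w j).2 : ℕ))
      (alloc fun j => (⟨0, zero_mem_deficitSet η⟩, (w j).2)) i)

theorem markedServed_mono (alloc : ClusterState M T η → Fin M → ℕ)
    {w w' : Fin M → Bool × Fin (T + 1)} (h2 : ∀ i, (w i).2 = (w' i).2)
    (h1 : ∀ i, (w i).1 = true → (w' i).1 = true) :
    markedServed N alloc w ≤ markedServed N alloc w' := by
  classical
  unfold markedServed
  simp only [h2]
  exact min_le_min_right _ (Finset.card_le_card
    (Finset.monotone_filter_right _ fun i _ hi => ⟨h1 i hi.1, hi.2⟩))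

/-- A newly marked agent adds at most one to the number of decoding agents among the marked ones. -/
theorem markedServed_add_le (alloc : ClusterState M T η → Fin M → ℕ)
    {w w' : Fin M → Bool × Fin (T + 1)} (h2 : ∀ i, (w i).2 = (w' i).2)
    (h1 : ∀ i, (w i).1 = true → (w' i).1 = true) :
    markedServed N alloc w' + ∑ i, (if (w i).1 = true then 1 else 0) ≤
      markedServed N alloc w + ∑ i, (if (w' i).1 = true then 1 else 0) := by
  classical
  unfold markedServed
  simp only [h2]
  have h3 : ∑ i, (if (w i).1 = true then 1 else 0) ≤
      ∑ i, (if (w' i).1 = true then 1 else 0) := by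
    refine Finset.sum_le_sum fun i _ => ?_
    have := h1 i
    split_ifs <;> simp_all
  have h4 : (Finset.univ.filter fun i => (w' i).1 = true ∧
        CanDecode N T (fun j => ((w' j).2 : ℕ)) i).card + ∑ i, (if (w i).1 = true then 1 else 0) ≤
      (Finset.univ.filter fun i => (w i).1 = true ∧
        CanDecode N T (fun j => ((w' j).2 : ℕ)) i).card +
        ∑ i, (if (w' i).1 = true then 1 else 0) := by
    rw [Finset.card_filter, Finset.card_filter, ← Finset.sum_add_distrib,
      ← Finset.sum_add_distrib]
    refine Finset.sum_le_sum fun i _ => ?_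
    have := h1 i
    split_ifs <;> simp_all
  omega

variable {α : Type*} [MeasurableSpace α]

/-- The states of the agents of a cluster, with the first component replaced by a mark. -/
def marks (p : α → Bool) (θ : Fin M → α × Fin (T + 1)) (i : Fin M) : Bool × Fin (T + 1) :=
  (p (θ i).1, (θ i).2)

theorem measurable_marks {p : α → Bool} (hp : Measurable p) :
    Measurable (marks p : (Fin M → α × Fin (T + 1)) → _) := by
  unfold marks
  fun_prop

theorem integrable_comp_marks {p : α → Bool} (hp : Measurable p)
    (ν : Measure (Fin M → α × Fin (T + 1))) [IsFiniteMeasure ν]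
    (g : (Fin M → Bool × Fin (T + 1)) → ℝ) : Integrable (fun θ => g (marks p θ)) ν :=
  (Integrable.of_finite (μ := ν.map (marks p)) (f := g)).comp_measurable (measurable_marks hp)

theorem map_marks {p : α → Bool} (hp : Measurable p) (μ : Measure α) [IsProbabilityMeasure μ]
    (ζ : Measure (Fin (T + 1))) [IsProbabilityMeasure ζ] :
    (Measure.pi fun _ : Fin M => μ.prod ζ).map (marks p) =
      Measure.pi fun _ => (μ.map p).prod ζ := by
  have hf : Measurable (Prod.map p (id : Fin (T + 1) → Fin (T + 1))) := hp.prodMap measurable_id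
  have : IsProbabilityMeasure (μ.map p) := Measure.isProbabilityMeasure_map hp.aemeasurable
  have hmap : (μ.prod ζ).map (Prod.map p id) = (μ.map p).prod ζ := by
    rw [← Measure.map_prod_map μ ζ hp measurable_id, Measure.map_id]
  have hσ : ∀ _ : Fin M, SigmaFinite ((μ.prod ζ).map (Prod.map p id)) := fun _ => by
    rw [hmap]
    infer_instance
  have := Measure.pi_map_pi (μ := fun _ : Fin M => μ.prod ζ) (f := fun _ => Prod.map p id)
    (hμ := hσ) fun _ => hf.aemeasurable
  rw [hmap] at this
  exact this

/-- The law of the marked states depends on the marks only through the probability of a mark. -/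
theorem integral_comp_marks_eq {α' : Type*} [MeasurableSpace α'] {p : α → Bool} {p' : α' → Bool}
    (hp : Measurable p) (hp' : Measurable p') (μ : Measure α) [IsProbabilityMeasure μ]
    (μ' : Measure α') [IsProbabilityMeasure μ'] (ζ : Measure (Fin (T + 1)))
    [IsProbabilityMeasure ζ] (h : μ.real {x | p x = true} = μ'.real {x | p' x = true})
    (g : (Fin M → Bool × Fin (T + 1)) → ℝ) :
    ∫ θ, g (marks p θ) ∂(Measure.pi fun _ => μ.prod ζ) =
      ∫ θ, g (marks p' θ) ∂(Measure.pi fun _ => μ'.prod ζ) := by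
  have h1 : IsProbabilityMeasure (μ.map p) := Measure.isProbabilityMeasure_map hp.aemeasurable
  have h2 : IsProbabilityMeasure (μ'.map p') := Measure.isProbabilityMeasure_map hp'.aemeasurable
  have htrue : (μ.map p) {true} = (μ'.map p') {true} := by
    rw [Measure.map_apply hp (measurableSet_singleton _),
      Measure.map_apply hp' (measurableSet_singleton _)]
    exact (measureReal_eq_measureReal_iff).1 h
  have hmap : μ.map p = μ'.map p' := by
    refine Measure.ext_of_singleton fun b => ?_
    cases b
    · have hc : ({false} : Set Bool) = {true}ᶜ := by ext b; cases b <;> simp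
      rw [hc, prob_compl_eq_one_sub (measurableSet_singleton _),
        prob_compl_eq_one_sub (measurableSet_singleton _), htrue]
    · exact htrue
  have hg : ∀ ν : Measure (Fin M → Bool × Fin (T + 1)), AEStronglyMeasurable g ν := fun ν =>
    (measurable_of_countable g).aestronglyMeasurable
  rw [← integral_map (measurable_marks hp).aemeasurable (hg _),
    ← integral_map (measurable_marks hp').aemeasurable (hg _), map_marks hp, map_marks hp', hmap]

theorem integral_card_marks {p : α → Bool} (hp : Measurable p) (μ : Measure α)
    [IsProbabilityMeasure μ] (ζ : Measure (Fin (T + 1))) [IsProbabilityMeasure ζ] :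
    ∫ θ, ∑ i, (if (marks p θ i).1 = true then (1 : ℝ) else 0)
      ∂(Measure.pi fun _ : Fin M => μ.prod ζ) = M * μ.real {x | p x = true} := by
  rw [integral_finsetSum _ fun i _ => integrable_comp_marks hp _
    fun w => if (w i).1 = true then (1 : ℝ) else 0]
  have hA : MeasurableSet {x | p x = true} := hp (measurableSet_singleton true)
  have hi : ∀ i : Fin M, ∫ θ, (if (marks p θ i).1 = true then (1 : ℝ) else 0)
      ∂(Measure.pi fun _ : Fin M => μ.prod ζ) = μ.real {x | p x = true} := by
    intro i
    have hmp : MeasurePreserving (fun θ : Fin M → α × Fin (T + 1) => (θ i).1)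
        (Measure.pi fun _ : Fin M => μ.prod ζ) μ :=
      measurePreserving_fst.comp (measurePreserving_eval (fun _ : Fin M => μ.prod ζ) i)
    rw [← hmp.measureReal_preimage hA.nullMeasurableSet,
      ← integral_indicator_one (hmp.measurable hA)]
    refine integral_congr_ae (.of_forall fun θ => ?_)
    by_cases hθ : p (θ i).1 = true <;> simp [marks, indicator, hθ]
  simp [hi]

/-- The probability that a typical agent decodes and belongs to the top fraction `q` of the
population, in the order of the deficits. The position of an agent in the population is modelled by a
uniformly distributed number in `(0, 1]`. -/
noncomputable def servedAbove (N : ℕ) (alloc : ClusterState M T η → Fin M → ℕ)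
    (ζ : Measure (Fin (T + 1))) (q : ℝ) : ℝ :=
  (M : ℝ)⁻¹ * ∫ θ, (markedServed N alloc (marks (fun u : ℝ => decide (u ≤ q)) θ) : ℝ)
    ∂(Measure.pi fun _ : Fin M => (volume.restrict (Ioc (0 : ℝ) 1)).prod ζ)

theorem measurable_decide_le (q : ℝ) : Measurable fun u : ℝ => decide (u ≤ q) := by
  refine measurable_to_bool ?_
  have : (fun u : ℝ => decide (u ≤ q)) ⁻¹' {true} = Iic q := by ext; simp
  rw [this]
  exact measurableSet_Iic

instance isProbabilityMeasure_restrict_Ioc :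
    IsProbabilityMeasure (volume.restrict (Ioc (0 : ℝ) 1)) := ⟨by simp⟩

theorem real_restrict_Ioc {q : ℝ} (h0 : 0 ≤ q) (h1 : q ≤ 1) :
    (volume.restrict (Ioc (0 : ℝ) 1)).real {u | decide (u ≤ q) = true} = q := by
  have : {u : ℝ | decide (u ≤ q) = true} = Iic q := by ext; simp
  rw [this, measureReal_restrict_apply measurableSet_Iic, inter_comm, Ioc_inter_Iic,
    min_eq_right h1, Real.volume_real_Ioc_of_le h0, sub_zero]

variable (alloc : ClusterState M T η → Fin M → ℕ) (ζ : Measure (Fin (T + 1)))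
  [IsProbabilityMeasure ζ]

theorem monotone_servedAbove : Monotone (servedAbove N alloc ζ) := by
  intro q q' hq
  refine mul_le_mul_of_nonneg_left ?_ (by positivity)
  refine integral_mono
    (integrable_comp_marks (measurable_decide_le q) _ fun w => (markedServed N alloc w : ℝ))
    (integrable_comp_marks (measurable_decide_le q') _ fun w => (markedServed N alloc w : ℝ))
    fun θ => Nat.cast_le.2 (markedServed_mono alloc (fun i => rfl) fun i hi => ?_)
  simp only [marks, decide_eq_true_eq] at hi ⊢
  exact hi.trans hq

theorem servedAbove_sub_le (hM : 0 < M) {q q' : ℝ} (h0 : 0 ≤ q) (hq : q ≤ q') (h1 : q' ≤ 1) :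
    servedAbove N alloc ζ q' - servedAbove N alloc ζ q ≤ q' - q := by
  have hM' : (0 : ℝ) < M := Nat.cast_pos.2 hM
  have hc := integral_card_marks (M := M) (measurable_decide_le q)
    (volume.restrict (Ioc (0 : ℝ) 1)) ζ
  have hc' := integral_card_marks (M := M) (measurable_decide_le q')
    (volume.restrict (Ioc (0 : ℝ) 1)) ζ
  rw [real_restrict_Ioc h0 (hq.trans h1)] at hc
  rw [real_restrict_Ioc (h0.trans hq) h1] at hc'
  have hg := fun q : ℝ => integrable_comp_marks (measurable_decide_le q)
    (Measure.pi fun _ : Fin M => (volume.restrict (Ioc (0 : ℝ) 1)).prod ζ)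
    fun w => (markedServed N alloc w : ℝ)
  have hn := fun q : ℝ => integrable_comp_marks (measurable_decide_le q)
    (Measure.pi fun _ : Fin M => (volume.restrict (Ioc (0 : ℝ) 1)).prod ζ)
    fun w => ∑ i, (if (w i).1 = true then (1 : ℝ) else 0)
  have hle := integral_mono ((hg q').add (hn q)) ((hg q).add (hn q')) fun θ => by
    have := markedServed_add_le (N := N) alloc
      (w := marks (fun u : ℝ => decide (u ≤ q)) θ) (w' := marks (fun u : ℝ => decide (u ≤ q')) θ)
      (fun i => rfl) fun i hi => by
        simp only [marks, decide_eq_true_eq] at hi ⊢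
        exact hi.trans hq
    have := (Nat.cast_le (α := ℝ)).2 this
    push_cast at this
    exact this
  rw [integral_add' (hg q') (hn q), integral_add' (hg q) (hn q'), hc, hc'] at hle
  unfold servedAbove
  rw [← mul_sub, inv_mul_le_iff₀ hM', mul_sub]
  linarith

/-- The two increments of `servedAbove` and of its complement `q - servedAbove q` have the same
sign, so that their absolute values add up. -/
theorem abs_servedAbove_add (hM : 0 < M) {q q' : ℝ} (hq : q ∈ Icc (0 : ℝ) 1)
    (hq' : q' ∈ Icc (0 : ℝ) 1) :
    |(q - servedAbove N alloc ζ q) - (q' - servedAbove N alloc ζ q')| +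
      |servedAbove N alloc ζ q - servedAbove N alloc ζ q'| = |q - q'| := by
  rcases le_total q q' with h | h
  · have h1 := monotone_servedAbove (N := N) alloc ζ h
    have h2 := servedAbove_sub_le (N := N) alloc ζ hM hq.1 h hq'.2
    rw [abs_of_nonpos (by linarith), abs_of_nonpos (by linarith), abs_of_nonpos (by linarith)]
    ring
  · have h1 := monotone_servedAbove (N := N) alloc ζ h
    have h2 := servedAbove_sub_le (N := N) alloc ζ hM hq'.1 h hq.2
    rw [abs_of_nonneg (by linarith), abs_of_nonneg (by linarith), abs_of_nonneg (by linarith)]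
    ring

end Quantile

/-! ### The tail of a stationary deficit distribution -/

section Tail

open Set

variable {M N T : ℕ} {η δ : ℝ} {alloc : ClusterState M T η → Fin M → ℕ}

/-- The tail `s ↦ ρ (s, ∞)` of a deficit distribution. -/
noncomputable def tail (ρ : Measure (Deficit η)) (s : ℝ) : ℝ := ρ.real {d | s < (d : ℝ)}

theorem deficit_nonneg (d : Deficit η) : (0 : ℝ) ≤ d := by
  obtain ⟨x, k, m, hm, rfl⟩ := d
  have := Int.le_floor.1 hm
  push_cast at this
  simpa using this

theorem markedServed_deficits (halloc : IsMinDeficitFirstRule N T η alloc)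
    (θ : ClusterState M T η) (s : ℝ) :
    (markedServed N alloc (marks (fun d : Deficit η => decide (s < (d : ℝ))) θ) : ℝ) =
      ∑ i, if s < ((θ i).1 : ℝ) then (chi N (chunks θ) (alloc θ) i : ℝ) else 0 := by
  classical
  have hup := (halloc θ).sum_chi_upper (Finset.univ.filter fun i => s < ((θ i).1 : ℝ)) (by
    intro i hi j hj
    simp only [Finset.mem_filter, Finset.mem_univ, true_and, not_lt] at hi hj
    exact hi.trans_lt hj)
  have htot := (halloc θ).sum_chi_eq
    (halloc fun j => (⟨0, zero_mem_deficitSet η⟩, (θ j).2))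
  rw [htot, Finset.filter_filter] at hup
  rw [← Finset.sum_filter, ← Nat.cast_sum, hup]
  simp only [markedServed, marks, decide_eq_true_eq]
  rfl

theorem integral_served (hM : 0 < M) (halloc : IsMinDeficitFirstRule N T η alloc)
    (ζ : Measure (Fin (T + 1))) [IsProbabilityMeasure ζ] (ρ : Measure (Deficit η))
    [IsProbabilityMeasure ρ] (s : ℝ) :
    ∫ θ, ∑ i, (if s < ((θ i).1 : ℝ) then (chi N (chunks θ) (alloc θ) i : ℝ) else 0)
      ∂(Measure.pi fun _ : Fin M => ρ.prod ζ) = M * servedAbove N alloc ζ (tail ρ s) := by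
  have hM' : (M : ℝ) ≠ 0 := Nat.cast_ne_zero.2 hM.ne'
  simp_rw [← markedServed_deficits halloc _ s]
  rw [servedAbove, mul_inv_cancel_left₀ hM']
  refine integral_comp_marks_eq (measurable_of_countable _) (measurable_decide_le _) ρ _ ζ ?_
    fun w => (markedServed N alloc w : ℝ)
  rw [real_restrict_Ioc (q := tail ρ s) measureReal_nonneg measureReal_le_one]
  simp [tail]

/-- If the deficit of an agent is redrawn independently of everything else, the law of the state of
the cluster does not change. -/
theorem measurePreserving_update (ζ : Measure (Fin (T + 1))) [IsProbabilityMeasure ζ]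
    (ρ : Measure (Deficit η)) [IsProbabilityMeasure ρ] (i : Fin M) :
    MeasurePreserving
      (fun z : Deficit η × ClusterState M T η => Function.update z.2 i (z.1, (z.2 i).2))
      (ρ.prod (Measure.pi fun _ : Fin M => ρ.prod ζ)) (Measure.pi fun _ : Fin M => ρ.prod ζ) := by
  refine ⟨measurable_of_countable _, Measure.ext_of_singleton fun θ => ?_⟩
  rw [Measure.map_apply (measurable_of_countable _) (measurableSet_singleton _)]
  have hpre : (fun z : Deficit η × ClusterState M T η => Function.update z.2 i (z.1, (z.2 i).2)) ⁻¹'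
      {θ} = {(θ i).1} ×ˢ
        univ.pi (Function.update (fun j => {θ j}) i (univ ×ˢ {(θ i).2})) := by
    ext ⟨d, θ'⟩
    simp only [mem_preimage, mem_singleton_iff, mem_prod, mem_univ_pi]
    constructor
    · rintro rfl
      refine ⟨by simp, fun j => ?_⟩
      rcases eq_or_ne j i with rfl | hj
      · simp
      · simp [hj]
    · rintro ⟨rfl, h⟩
      funext j
      rcases eq_or_ne j i with rfl | hj
      · have := h j
        simp at this
        simp [this]
      · have := h j
        simp [hj] at this
        simp [hj, this]
  rw [hpre, Measure.prod_prod, Measure.pi_pi, Measure.pi_singleton,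
    ← Finset.mul_prod_erase _ _ (Finset.mem_univ i), ← Finset.mul_prod_erase (a := i) _ _
    (Finset.mem_univ i), Function.update_self, Measure.prod_prod, measure_univ, one_mul, ← mul_assoc,
    ← Measure.prod_prod, singleton_prod_singleton]
  congr 1
  refine Finset.prod_congr rfl fun j hj => ?_
  rw [Function.update_of_ne (Finset.ne_of_mem_erase hj)]

theorem lintegral_lawNoRegeneration (ζ : Measure (Fin (T + 1))) [IsProbabilityMeasure ζ]
    (ρ : Measure (Deficit η)) [IsProbabilityMeasure ρ] (i : Fin M) (B : Set (Deficit η)) :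
    ∫⁻ d, lawNoRegeneration N T η alloc ζ ρ i d B ∂ρ =
      (Measure.pi fun _ : Fin M => ρ.prod ζ) {θ | nextDeficit N T η alloc θ i ∈ B} := by
  rw [← (measurePreserving_update ζ ρ i).measure_preimage
    (MeasurableSet.of_discrete).nullMeasurableSet,
    Measure.prod_apply (MeasurableSet.of_discrete)]
  refine lintegral_congr fun d => ?_
  rw [lawNoRegeneration, Measure.map_apply (measurable_of_countable _) (MeasurableSet.of_discrete)]
  rfl

theorem IsMFE.measure_eq {ζ : Measure (Fin (T + 1))} [IsProbabilityMeasure ζ]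
    {Ψ ρ : Measure (Deficit η)} [IsProbabilityMeasure ρ] (h : IsMFE N T η δ alloc ζ Ψ ρ)
    (B : Set (Deficit η)) :
    ρ B = ENNReal.ofReal δ * ((M : ENNReal)⁻¹ * ∑ i : Fin M,
      (Measure.pi fun _ : Fin M => ρ.prod ζ) {θ | nextDeficit N T η alloc θ i ∈ B}) +
        ENNReal.ofReal (1 - δ) * Ψ B := by
  have hB : MeasurableSet B := .of_discrete
  conv_lhs => rw [← h.2.def, Measure.bind_apply hB (Kernel.aemeasurable _)]
  simp only [deficitKernel, Kernel.ofFunOfCountable, Kernel.coe_mk, Measure.add_apply,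
    Measure.smul_apply, Measure.finsetSum_apply, smul_eq_mul]
  rw [lintegral_add_left (measurable_of_countable _), lintegral_const, measure_univ, mul_one,
    lintegral_const_mul _ (measurable_of_countable _),
    lintegral_const_mul _ (measurable_of_countable _),
    lintegral_finsetSum _ fun _ _ => measurable_of_countable _]
  simp only [lintegral_lawNoRegeneration]

theorem chi_eq_zero_or_one (N : ℕ) (e a : Fin M → ℕ) (i : Fin M) :
    chi N e a i = 0 ∨ chi N e a i = 1 := by
  unfold chi
  split_ifs <;> simp

theorem indicator_nextDeficit (θ : ClusterState M T η) (i : Fin M) {t : ℝ} (ht : 0 ≤ t) :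
    (if t < (nextDeficit N T η alloc θ i : ℝ) then (1 : ℝ) else 0) =
      (if t - η < ((θ i).1 : ℝ) then 1 else 0) -
        (if t - η < ((θ i).1 : ℝ) then (chi N (chunks θ) (alloc θ) i : ℝ) else 0) +
        (if t - η + 1 < ((θ i).1 : ℝ) then (chi N (chunks θ) (alloc θ) i : ℝ) else 0) := by
  have h : t < (nextDeficit N T η alloc θ i : ℝ) ↔
      t - η + (chi N (chunks θ) (alloc θ) i : ℝ) < ((θ i).1 : ℝ) := by
    simp only [nextDeficit, lt_max_iff, not_lt.2 ht, or_false]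
    constructor <;> intro h <;> linarith
  simp only [h]
  rcases chi_eq_zero_or_one N (chunks θ) (alloc θ) i with hc | hc <;> rw [hc] <;> simp

/-- Stationarity in terms of the tail. An agent exceeds `t` after a frame if it exceeded `t - η`
before and did not decode, or if it exceeded `t - η + 1` before and decoded. -/
theorem IsMFE.tail_eq (hM : 0 < M) (hδ₀ : 0 ≤ δ) (hδ₁ : δ ≤ 1)
    (halloc : IsMinDeficitFirstRule N T η alloc) {ζ : Measure (Fin (T + 1))}
    [IsProbabilityMeasure ζ] {Ψ ρ : Measure (Deficit η)} [IsProbabilityMeasure Ψ]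
    [IsProbabilityMeasure ρ] (h : IsMFE N T η δ alloc ζ Ψ ρ) {t : ℝ} (ht : 0 ≤ t) :
    tail ρ t = δ * (tail ρ (t - η) - servedAbove N alloc ζ (tail ρ (t - η)) +
      servedAbove N alloc ζ (tail ρ (t - η + 1))) + (1 - δ) * tail Ψ t := by
  have hM' : (M : ℝ) ≠ 0 := Nat.cast_ne_zero.2 hM.ne'
  set P := Measure.pi fun _ : Fin M => ρ.prod ζ
  have hbound : ∀ f : ClusterState M T η → ℝ, (∀ θ, |f θ| ≤ 1) → Integrable f P := fun f hf =>
    .of_bound (measurable_of_countable f).aestronglyMeasurable 1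
      (.of_forall fun θ => by simpa using hf θ)
  have hchi : ∀ (i : Fin M) (s : ℝ), Integrable (fun θ : ClusterState M T η =>
      if s < ((θ i).1 : ℝ) then (chi N (chunks θ) (alloc θ) i : ℝ) else 0) P := fun i s => by
    refine hbound _ fun θ => ?_
    rcases chi_eq_zero_or_one N (chunks θ) (alloc θ) i with hc | hc <;> rw [hc] <;>
      split_ifs <;> simp
  have hone : ∀ (i : Fin M) (s : ℝ), Integrable (fun θ : ClusterState M T η =>
      if s < ((θ i).1 : ℝ) then (1 : ℝ) else 0) P := fun i s => by
    refine hbound _ fun θ => ?_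
    split_ifs <;> simp
  have hcard : ∫ θ, ∑ i, (if t - η < ((θ i).1 : ℝ) then (1 : ℝ) else 0) ∂P =
      M * tail ρ (t - η) := by
    have := integral_card_marks (M := M) (measurable_of_countable
      fun d : Deficit η => decide (t - η < (d : ℝ))) ρ ζ
    refine (integral_congr_ae (.of_forall fun θ => ?_)).trans (this.trans ?_)
    · simp [marks]
    · simp [tail]
  have hsum : ∑ i, P.real {θ | t < (nextDeficit N T η alloc θ i : ℝ)} =
      M * (tail ρ (t - η) - servedAbove N alloc ζ (tail ρ (t - η)) +
        servedAbove N alloc ζ (tail ρ (t - η + 1))) := by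
    have h1 : ∀ i, P.real {θ | t < (nextDeficit N T η alloc θ i : ℝ)} =
        ∫ θ, (if t < (nextDeficit N T η alloc θ i : ℝ) then (1 : ℝ) else 0) ∂P := fun i => by
      rw [← integral_indicator_one (MeasurableSet.of_discrete)]
      exact integral_congr_ae (.of_forall fun θ => by simp [indicator])
    simp_rw [h1, indicator_nextDeficit _ _ ht]
    refine (integral_finsetSum Finset.univ fun i _ => ((hone i (t - η)).sub
      (hchi i (t - η))).add (hchi i (t - η + 1))).symm.trans ?_
    simp_rw [Pi.add_apply, Pi.sub_apply, Finset.sum_add_distrib, Finset.sum_sub_distrib]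
    have hI1 := integrable_finsetSum Finset.univ fun i _ => hone i (t - η)
    have hI2 := integrable_finsetSum Finset.univ fun i _ => hchi i (t - η)
    have hI3 := integrable_finsetSum Finset.univ fun i _ => hchi i (t - η + 1)
    refine (integral_add (hI1.sub hI2) hI3).trans ?_
    simp only [Pi.sub_apply]
    rw [integral_sub hI1 hI2, hcard,
      integral_served hM halloc, integral_served hM halloc]
    ring
  have hmeas := congrArg ENNReal.toReal (h.measure_eq {d | t < (d : ℝ)})
  rw [ENNReal.toReal_add, ENNReal.toReal_mul, ENNReal.toReal_mul, ENNReal.toReal_mul,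
    ENNReal.toReal_inv, ENNReal.toReal_natCast, ENNReal.toReal_sum fun _ _ => measure_ne_top _ _,
    ENNReal.toReal_ofReal hδ₀, ENNReal.toReal_ofReal (sub_nonneg.2 hδ₁)] at hmeas
  · change tail ρ t = δ * ((M : ℝ)⁻¹ *
      ∑ i, P.real {θ | t < (nextDeficit N T η alloc θ i : ℝ)}) + (1 - δ) * tail Ψ t at hmeas
    rw [hmeas, hsum, inv_mul_cancel_left₀ hM']
  · refine ENNReal.mul_ne_top ENNReal.ofReal_ne_top (ENNReal.mul_ne_top ?_ ?_)
    · simpa using hM.ne'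
    · exact (ENNReal.sum_lt_top.2 fun _ _ => measure_lt_top _ _).ne
  · exact ENNReal.mul_ne_top ENNReal.ofReal_ne_top (measure_ne_top _ _)

end Tail

/-! ### Contraction of the tails and uniqueness -/

section Contraction

open Set Filter Topology

variable {M N T : ℕ} {η δ : ℝ} {alloc : ClusterState M T η → Fin M → ℕ}

theorem antitone_tail (ρ : Measure (Deficit η)) [IsFiniteMeasure ρ] : Antitone (tail ρ) :=
  fun _ _ hst => measureReal_mono fun _ hd => hst.trans_lt hd

theorem tail_mem_Icc (ρ : Measure (Deficit η)) [IsProbabilityMeasure ρ] (s : ℝ) :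
    tail ρ s ∈ Icc (0 : ℝ) 1 := ⟨measureReal_nonneg, measureReal_le_one⟩

theorem tail_of_neg (ρ : Measure (Deficit η)) [IsProbabilityMeasure ρ] {s : ℝ} (hs : s < 0) :
    tail ρ s = 1 := by
  have : {d : Deficit η | s < (d : ℝ)} = univ := eq_univ_of_forall fun d =>
    hs.trans_le (deficit_nonneg d)
  rw [tail, this, probReal_univ]

theorem integrableOn_tail {ρ : Measure (Deficit η)} (h : IsFiniteMeanProb ρ) :
    IntegrableOn (tail ρ) (Ici 0) := by
  have := h.1
  rw [integrableOn_Ici_iff_integrableOn_Ioi]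
  refine ⟨(antitone_tail ρ).measurable.aestronglyMeasurable, ?_⟩
  have hlayer := lintegral_eq_lintegral_meas_lt ρ (f := fun d : Deficit η => (d : ℝ))
    (.of_forall deficit_nonneg) (measurable_of_countable _).aemeasurable
  have hfin := h.2.lintegral_lt_top
  rw [hlayer] at hfin
  refine lt_of_eq_of_lt (lintegral_congr fun s => ?_) hfin
  rw [Real.enorm_of_nonneg (tail_mem_Icc ρ s).1, tail, ofReal_measureReal]

theorem integrable_tail_sub {ρ₁ ρ₂ : Measure (Deficit η)} (h₁ : IsFiniteMeanProb ρ₁)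
    (h₂ : IsFiniteMeanProb ρ₂) : Integrable fun s => tail ρ₁ s - tail ρ₂ s := by
  have := h₁.1
  have := h₂.1
  refine (((integrableOn_tail h₁).sub (integrableOn_tail h₂)).integrable_indicator
    measurableSet_Ici).congr (.of_forall fun s => ?_)
  rcases lt_or_ge s 0 with hs | hs
  · rw [indicator_of_notMem (notMem_Ici.2 hs), eq_comm]
    simp only [tail_of_neg ρ₁ hs, tail_of_neg ρ₂ hs, sub_self]
  · rw [indicator_of_mem (mem_Ici.2 hs)]
    rfl

theorem cdf_map_coe (ρ : Measure (Deficit η)) [IsProbabilityMeasure ρ] (s : ℝ) :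
    cdf (ρ.map ((↑) : Deficit η → ℝ)) s = 1 - tail ρ s := by
  have hm : Measurable ((↑) : Deficit η → ℝ) := measurable_of_countable _
  have := Measure.isProbabilityMeasure_map (μ := ρ) hm.aemeasurable
  rw [cdf_eq_real, map_measureReal_apply hm measurableSet_Iic, tail,
    ← probReal_compl_eq_one_sub .of_discrete]
  congr 1
  ext d
  simp

/-- A deficit distribution is determined by its tail, up to null sets, as the tail is
right-continuous. -/
theorem eq_of_tail_ae_eq {ρ₁ ρ₂ : Measure (Deficit η)} [IsProbabilityMeasure ρ₁]
    [IsProbabilityMeasure ρ₂] (h : tail ρ₁ =ᵐ[volume] tail ρ₂) : ρ₁ = ρ₂ := by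
  have hm : Measurable ((↑) : Deficit η → ℝ) := measurable_of_countable _
  have := Measure.isProbabilityMeasure_map (μ := ρ₁) hm.aemeasurable
  have := Measure.isProbabilityMeasure_map (μ := ρ₂) hm.aemeasurable
  have hcdf : cdf (ρ₁.map ((↑) : Deficit η → ℝ)) = cdf (ρ₂.map ((↑) : Deficit η → ℝ)) := by
    ext s
    have hlim := fun ρ : Measure (Deficit η) =>
      ((cdf (ρ.map ((↑) : Deficit η → ℝ))).right_continuous s).mono Ioi_subset_Ici_self
    have hfreq : ∃ᶠ r in 𝓝[>] s, cdf (ρ₁.map ((↑) : Deficit η → ℝ)) r =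
        cdf (ρ₂.map ((↑) : Deficit η → ℝ)) r := by
      intro hne
      obtain ⟨u, hu, hsub⟩ := (mem_nhdsGT_iff_exists_Ioo_subset).1 hne
      have hnull : volume (Ioo s u) = 0 := by
        refine measure_mono_null (fun r hr => ?_) (ae_iff.1 h)
        have hr' := hsub hr
        simp only [mem_ofPred_eq, cdf_map_coe] at hr' ⊢
        exact fun heq => hr' (by rw [heq])
      rw [Real.volume_Ioo, ENNReal.ofReal_eq_zero] at hnull
      exact absurd (mem_Ioi.1 hu) (not_lt.2 (by linarith))
    exact tendsto_nhds_unique_of_frequently_eq (hlim ρ₁) (hlim ρ₂) hfreq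
  have hmap := Measure.eq_of_cdf _ _ hcdf
  have hemb : MeasurableEmbedding ((↑) : Deficit η → ℝ) :=
    .subtype_coe (Set.to_countable (deficitSet η)).measurableSet
  rw [← hemb.comap_map ρ₁, hmap, hemb.comap_map]

/-- The map from the tail of a deficit distribution to its tail one frame later is a contraction for
the `L¹` distance, with factor `δ`. -/
theorem IsMFE.integral_abs_le (hM : 0 < M) (hδ₀ : 0 ≤ δ) (hδ₁ : δ ≤ 1)
    (halloc : IsMinDeficitFirstRule N T η alloc) {ζ : Measure (Fin (T + 1))}
    [IsProbabilityMeasure ζ] {Ψ ρ₁ ρ₂ : Measure (Deficit η)} [IsProbabilityMeasure Ψ]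
    (h₁ : IsMFE N T η δ alloc ζ Ψ ρ₁) (h₂ : IsMFE N T η δ alloc ζ Ψ ρ₂) :
    ∫ s, |tail ρ₁ s - tail ρ₂ s| ≤ δ * ∫ s, |tail ρ₁ s - tail ρ₂ s| := by
  have := h₁.1.1
  have := h₂.1.1
  have hw := (integrable_tail_sub h₁.1 h₂.1).abs
  set H := servedAbove N alloc ζ
  set f := fun s => |H (tail ρ₁ s) - H (tail ρ₂ s)|
  set g := fun s => |(tail ρ₁ s - H (tail ρ₁ s)) - (tail ρ₂ s - H (tail ρ₂ s))|
  have hgf : ∀ s, g s + f s = |tail ρ₁ s - tail ρ₂ s| := fun s =>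
    abs_servedAbove_add alloc ζ hM (tail_mem_Icc ρ₁ s) (tail_mem_Icc ρ₂ s)
  have ht₁ := (antitone_tail ρ₁).measurable
  have ht₂ := (antitone_tail ρ₂).measurable
  have hH : Measurable H := (monotone_servedAbove alloc ζ).measurable
  have hfi : Integrable f := hw.mono' (by fun_prop) (.of_forall fun s => by
    rw [Real.norm_of_nonneg (abs_nonneg _), ← hgf s]
    exact le_add_of_nonneg_left (abs_nonneg _))
  have hgi : Integrable g := hw.mono' (by fun_prop) (.of_forall fun s => by
    rw [Real.norm_of_nonneg (abs_nonneg _), ← hgf s]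
    exact le_add_of_nonneg_right (abs_nonneg _))
  have hgs := hgi.comp_sub_right η
  have hfs := hfi.comp_sub_right (η - 1)
  have hstep : ∀ t, |tail ρ₁ t - tail ρ₂ t| ≤ δ * (g (t - η) + f (t - (η - 1))) := by
    intro t
    rcases lt_or_ge t 0 with ht | ht
    -- Deficits are nonnegative, so that all tails are equal to `1` here.
    · rw [tail_of_neg ρ₁ ht, tail_of_neg ρ₂ ht, sub_self, abs_zero]
      exact mul_nonneg hδ₀ (add_nonneg (abs_nonneg _) (abs_nonneg _))
    · rw [h₁.tail_eq hM hδ₀ hδ₁ halloc ht, h₂.tail_eq hM hδ₀ hδ₁ halloc ht,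
        ← sub_add t η 1, add_sub_add_right_eq_sub, ← mul_sub, abs_mul, abs_of_nonneg hδ₀,
        add_sub_add_comm]
      exact mul_le_mul_of_nonneg_left (abs_add_le _ _) hδ₀
  calc ∫ s, |tail ρ₁ s - tail ρ₂ s|
      ≤ ∫ t, δ * (g (t - η) + f (t - (η - 1))) :=
        integral_mono hw ((hgs.add hfs).const_mul δ) hstep
    _ = δ * (∫ s, g s + f s) := by
        rw [integral_const_mul, integral_add hgs hfs, integral_sub_right_eq_self g,
          integral_sub_right_eq_self f, integral_add hgi hfi]
    _ = δ * ∫ s, |tail ρ₁ s - tail ρ₂ s| := by simp_rw [hgf]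

theorem IsMFE.unique (hM : 0 < M) (hδ₀ : 0 ≤ δ) (hδ₁ : δ < 1)
    (halloc : IsMinDeficitFirstRule N T η alloc) {ζ : Measure (Fin (T + 1))}
    [IsProbabilityMeasure ζ] {Ψ ρ₁ ρ₂ : Measure (Deficit η)} [IsProbabilityMeasure Ψ]
    (h₁ : IsMFE N T η δ alloc ζ Ψ ρ₁) (h₂ : IsMFE N T η δ alloc ζ Ψ ρ₂) : ρ₁ = ρ₂ := by
  have := h₁.1.1
  have := h₂.1.1
  have hw := (integrable_tail_sub h₁.1 h₂.1).abs
  have hle := h₁.integral_abs_le hM hδ₀ hδ₁.le halloc h₂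
  have hnn : 0 ≤ ∫ s, |tail ρ₁ s - tail ρ₂ s| := integral_nonneg fun s => abs_nonneg _
  have hzero : ∫ s, |tail ρ₁ s - tail ρ₂ s| = 0 := by nlinarith
  rw [integral_eq_zero_iff_of_nonneg (fun s => abs_nonneg _) hw] at hzero
  refine eq_of_tail_ae_eq (hzero.mono fun s hs => ?_)
  exact sub_eq_zero.1 (abs_eq_zero.1 hs)

end Contraction

end D2DStreaming

theorem mainTheorem4 (M N T : ℕ) (hM : 0 < M)
    (η δ : ℝ) (hη₀ : 0 < η) (hη₁ : η ≤ 1) (hδ₀ : 0 < δ) (hδ₁ : δ < 1)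
    (ζ : MeasureTheory.Measure (Fin (T + 1))) (hζ : MeasureTheory.IsProbabilityMeasure ζ)
    (Ψ : MeasureTheory.Measure (D2DStreaming.Deficit η)) (hΨ : D2DStreaming.IsFiniteMeanProb Ψ)
    (alloc : D2DStreaming.ClusterState M T η → Fin M → ℕ)
    (halloc : D2DStreaming.IsMinDeficitFirstRule N T η alloc)
    (ρ₁ ρ₂ : MeasureTheory.Measure (D2DStreaming.Deficit η))
    (h₁ : D2DStreaming.IsMFE N T η δ alloc ζ Ψ ρ₁)
    (h₂ : D2DStreaming.IsMFE N T η δ alloc ζ Ψ ρ₂) :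
    ρ₁ = ρ₂ := by
  have := hΨ.1
  exact h₁.unique hM hδ₀.le hδ₁ halloc h₂
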